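/- **Theorem 5.1.** Every treelike snark $G(T_0,C_0)$ has excessive index at least $5$; that is, its edge set cannot be covered by four (or fewer) perfect matchings. Here the *excessive index* of a graph $G$ is the least number $k$ such that there are $k$ perfect matchings of $G$ whose union contains every edge of $G$ (and it is $\infty$ if there is no such $k$). The *Petersen fragment* $F_0$, with loose half-edges $a_1,\dots,a_5$, is obtained from the Petersen graph as follows: remove a vertex $x$ with neighbours $y,z,t$, keeping the half-edges $a_3,a_4,a_5$ incident with $y,z,t$ respectively; subdivide each of the two remaining edges incident with $y$ by one new vertex; and add a half-edge at each of these two new vertices, $a_1$ at one of them and $a_2$ at the other (up to isomorphism the choices do not matter). A *cubic Halin graph* $H_0$ is a finite plane graph which consists of a plane tree $T_0$, all of whose vertices have degree $1$ or $3$ and at least one of which has degree $3$, and of a circuit $C_0$ on the set of leaves of $T_0$; thus $C_0$ passes through the leaves in the cyclic order in which they occur around the plane tree. Fix a direction of $C_0$. The *treelike snark* $G(T_0,C_0)$ is the cubic graph obtained from $T_0$ as follows: * each leaf $\ell$ of $T_0$ is replaced by a copy $F_0^\ell$ of $F_0$, the edge of $T_0$ at $\ell$ being joined to the half-edge $a_3$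 of $F_0^\ell$, so that the neighbour of $\ell$ in $T_0$ becomes adjacent to the vertex of $F_0^\ell$ incident with $a_3$; * for each leaf $\ell$ with successor $\ell'$ on $C_0$, where $F_0^\ell$ has loose half-edges $(a_1,\dots,a_5)$ and $F_0^{\ell'}$ has loose half-edges $(a_1',\dots,a_5')$, the half-edge $a_4$ is joined to $a_2'$ and $a_5$ is joined to $a_1'$, forming two new edges. -/

import Mathlib

/-! ### Perfect matching covers and the excessive index -/

/-- A cover of `G`: a set of perfect matchings of `G` such that each edge of `G` belongs to at
least one of them. -/
def IsPerfectMatchingCover {V : Type*} (G : SimpleGraph V) (𝓜 : Set G.Subgraph) : Prop :=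
  (∀ M ∈ 𝓜, M.IsPerfectMatching) ∧ ∀ e ∈ G.edgeSet, ∃ M ∈ 𝓜, e ∈ M.edgeSet

/-- The excessive index of `G`: the least number of perfect matchings in a cover of `G`
(it is `⊤` if `G` has no finite cover). -/
noncomputable def excessiveIndex {V : Type*} (G : SimpleGraph V) : ℕ∞ :=
  ⨅ (𝓜 : Set G.Subgraph) (_ : IsPerfectMatchingCover G 𝓜), 𝓜.encard

/-! ### Fragments and the Petersen fragment -/

/-- A fragment on the vertex set `W`: a cubic generalised graph with exactly five loose
half-edges in a fixed order `a₁, …, a₅`. The half-edge `aᵢ₊₁` is recorded by the vertex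
`spoke i` (`i = 0, …, 4`) with which it is incident. -/
structure Fragment (W : Type*) where
  graph : SimpleGraph W
  spoke : Fin 5 → W
  cubic : ∀ w, (graph.neighborSet w).ncard + {i | spoke i = w}.ncard = 3

/-- The Petersen graph: an outer 5-circuit `0,1,2,3,4`, an inner pentagram `5,7,9,6,8`, and the
edges joining `i` to `i + 5`. -/
def petersenGraph : SimpleGraph (Fin 10) :=
  SimpleGraph.fromRel fun i j =>
    (i.val < 5 ∧ j.val = (i.val + 1) % 5) ∨
    (i.val < 5 ∧ j.val = i.val + 5) ∨
    (5 ≤ i.val ∧ j.val = 5 + (i.val + 2) % 5)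

instance : DecidableRel petersenGraph.Adj := fun i j => by
  unfold petersenGraph; infer_instance

/-- The vertices of the Petersen fragment: the vertices of the Petersen graph other than the
removed vertex `x = 0`, and two subdivision vertices. -/
abbrev PetersenFragmentVertex : Type := {v : Fin 10 // v ≠ 0} ⊕ Fin 2

/-- Adjacency in the Petersen fragment. The removed vertex is `x = 0`, with neighbours `y = 1`,
`z = 4`, `t = 5`. The two remaining edges at `y`, namely `{1, 2}` and `{1, 6}`, are
subdivided by the vertices `inr 0` and `inr 1` respectively. -/
def petersenFragmentAdj : PetersenFragmentVertex → PetersenFragmentVertex → Prop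
  | .inl u, .inl v => petersenGraph.Adj u v ∧ u.val ≠ 1 ∧ v.val ≠ 1
  | .inl u, .inr s => u.val = 1 ∨ u.val = if s = 0 then 2 else 6
  | .inr s, .inl u => u.val = 1 ∨ u.val = if s = 0 then 2 else 6
  | .inr _, .inr _ => False

instance : DecidableRel petersenFragmentAdj := fun p q => by
  rcases p with p | p <;> rcases q with q | q <;> unfold petersenFragmentAdj <;> infer_instance

/-- The underlying graph of the Petersen fragment. -/
def petersenFragmentGraph : SimpleGraph PetersenFragmentVertex where
  Adj := petersenFragmentAdj
  symm := ⟨by decide +kernel⟩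
  loopless := ⟨by decide +kernel⟩

instance : DecidableRel petersenFragmentGraph.Adj :=
  inferInstanceAs (DecidableRel petersenFragmentAdj)

/-- The loose half-edges of the Petersen fragment: `a₁`, `a₂` at the two subdivision vertices,
and `a₃`, `a₄`, `a₅` at the neighbours `y = 1`, `z = 4`, `t = 5` of the removed vertex. -/
def petersenFragmentSpoke : Fin 5 → PetersenFragmentVertex :=
  ![.inr 0, .inr 1, .inl ⟨1, by decide⟩, .inl ⟨4, by decide⟩, .inl ⟨5, by decide⟩]

/-- The Petersen fragment `F₀`. -/
def petersenFragment : Fragment PetersenFragmentVertex where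
  graph := petersenFragmentGraph
  spoke := petersenFragmentSpoke
  cubic := by
    intro w
    rw [Set.ncard_eq_toFinset_card', Set.ncard_eq_toFinset_card']
    revert w
    decide +kernel

/-! ### Cubic Halin graphs -/

/-- A leaf: a vertex of degree one. -/
def IsLeafOf {V : Type*} (T : SimpleGraph V) (v : V) : Prop :=
  (T.neighborSet v).ncard = 1

/-- A rotation system on `T`: a permutation of the darts (directed edges) of `T` that permutes
cyclically, at each vertex `v`, the darts leaving `v`. For a tree, these are exactly the
planar representations, up to homeomorphism of the plane: `rot d` is the dart which follows `d`
in the clockwise order around the vertex `d.fst`. -/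
structure IsRotationSystem {V : Type*} (T : SimpleGraph V) (rot : Equiv.Perm T.Dart) : Prop where
  fst_eq : ∀ d, (rot d).fst = d.fst
  sameCycle : ∀ d d' : T.Dart, d.fst = d'.fst → rot.SameCycle d d'

/-- One step of the walk along the boundary of a face of the represented graph: having traversed
the dart `d`, continue with the dart which follows the reverse of `d` around `d.snd`. A tree in
the plane has only one face, and iterating this step is walking around the tree. -/
def contourStep {V : Type*} {T : SimpleGraph V} (rot : Equiv.Perm T.Dart) (d : T.Dart) : T.Dart :=
  rot d.symm

/-- A cubic Halin graph with vertex set `V`, consisting of a tree `tree` without vertices of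
degree two, represented in the plane, and of a circuit on the set of its leaves, which together
form a plane graph; the circuit, with a fixed direction, is given by the successor `next ℓ` of
each leaf `ℓ`. As the graph is cubic, the degrees in the tree are `1` and `3`. As the circuit
does not cross the tree, it passes through the leaves in the order in which they are met on the
walk around the tree. (The other direction of the circuit belongs to the mirror image.) -/
structure CubicHalinGraph (V : Type*) where
  tree : SimpleGraph V
  isTree : tree.IsTree
  degree_eq : ∀ v, (tree.neighborSet v).ncard = 1 ∨ (tree.neighborSet v).ncard = 3
  /-- The tree is not a single edge (the two leaves of which carry no circuit). -/
  exists_degree_eq_three : ∃ v, (tree.neighborSet v).ncard = 3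
  rot : Equiv.Perm tree.Dart
  isRotationSystem : IsRotationSystem tree rot
  next : Equiv.Perm {v : V // IsLeafOf tree v}
  /-- The leaves form one circuit. -/
  isCycleOn_next : next.IsCycleOn Set.univ
  /-- On the walk around the tree that starts at the leaf `ℓ`, the first leaf that is met is
  `next ℓ`. -/
  next_contour : ∀ (ℓ : {v : V // IsLeafOf tree v}) (d : tree.Dart), d.fst = ℓ.val →
    ∃ n : ℕ, ((contourStep rot)^[n] d).snd = (next ℓ).val ∧
      ∀ m < n, ¬ IsLeafOf tree ((contourStep rot)^[m] d).snd

/-! ### Treelike snarks -/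

namespace CubicHalinGraph

/-- The vertices of the treelike snark: the vertices of the tree of degree three, and, in place
of each leaf `ℓ`, the vertices `(ℓ, p)` of a copy of the Petersen fragment. -/
abbrev SnarkVertex {V : Type*} (H : CubicHalinGraph V) : Type _ :=
  {v : V // ¬ IsLeafOf H.tree v} ⊕ ({v : V // IsLeafOf H.tree v} × PetersenFragmentVertex)

/-- The edges of the treelike snark, each in one of its directions or in both:
* the edges of the tree between vertices of degree three;
* for each leaf `ℓ`, the half-edge `a₃` of its fragment, attached to the tree in place of `ℓ`,
  that is, to the neighbour of `ℓ` in the tree;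
* the edges inside the fragment of each leaf `ℓ`;
* for each leaf `ℓ` and its successor `ℓ'`, the edges joining `a₄` to `a'₂` and `a₅` to `a'₁`. -/
def snarkRel {V : Type*} (H : CubicHalinGraph V) : H.SnarkVertex → H.SnarkVertex → Prop
  | .inl u, .inl v => H.tree.Adj u v
  | .inl u, .inr (ℓ, p) => H.tree.Adj u ℓ ∧ p = petersenFragment.spoke 2
  | .inr _, .inl _ => False
  | .inr (ℓ, p), .inr (ℓ', q) =>
      (ℓ = ℓ' ∧ petersenFragment.graph.Adj p q) ∨
      (ℓ' = H.next ℓ ∧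
        ((p = petersenFragment.spoke 3 ∧ q = petersenFragment.spoke 1) ∨
         (p = petersenFragment.spoke 4 ∧ q = petersenFragment.spoke 0)))

/-- The treelike snark `G(T₀, C₀)` of a cubic Halin graph with tree `T₀` and circuit `C₀`. -/
def treelikeSnark {V : Type*} (H : CubicHalinGraph V) : SimpleGraph H.SnarkVertex :=
  SimpleGraph.fromRel H.snarkRel

end CubicHalinGraph

/-! ### Colour sets and boundary states -/

/-! Suppose that four perfect matchings cover the snark. Each edge then carries a nonempty set of
colours from `{0, 1, 2, 3}`, and at each vertex the three sets partition the colours. Of the two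
edges joining consecutive fragments only a state is kept: the symmetric difference of their colour
sets, and whether these meet.

A fragment has 11 vertices, so each matching uses an odd number of its five half-edges; hence the
two end states determine the colour set of `a₃`, which is `treeColour`. Enumerating the perfect
matchings of the fragment shows that its end states satisfy `SingleRel` (`fragmentStates_of_cover`).

The part of the snark beyond a directed tree edge is a run of consecutive fragments. At a branch
vertex two runs sharing a middle state merge; their tree edges have disjoint colour sets that leave
some colour to the third edge. A finite check (`compositeRel_of_comp`) then gives `CompositeRel` for
the merged run, so by induction over the tree (`exists_rel_of_dart`) it holds for every run of at
least two fragments. Cut the circuit at the fragment of a leaf `r`: the remaining fragments form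
such a run, whose end states are those of the fragment of `r` in reverse. No pair satisfies
`CompositeRel` one way and `SingleRel` the other (`not_singleRel_of_compositeRel`). -/

/-- Exactly one of three Booleans is true. -/
def exactlyOne (a b c : Bool) : Bool :=
  (a && !b && !c) || (!a && b && !c) || (!a && !b && c)

/-- A set of colours from `{0, 1, 2, 3}`, given by its characteristic function. -/
def colourSet (c : Fin 4 → Bool) : BitVec 4 :=
  BitVec.ofNat 4 ((c 0).toNat + 2 * (c 1).toNat + 4 * (c 2).toNat + 8 * (c 3).toNat)

/-- The information kept about the colour sets of a pair of edges: their symmetric difference, and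
whether they meet. -/
abbrev PairState : Type := BitVec 4 × Bool

def pairState (x y : BitVec 4) : PairState := (x ^^^ y, x &&& y != 0)

theorem pairState_comm (x y : BitVec 4) : pairState x y = pairState y x := by
  simp only [pairState, BitVec.xor_comm x y, BitVec.and_comm x y]

def colourCount (x : BitVec 4) : ℕ :=
  x[0].toNat + x[1].toNat + x[2].toNat + x[3].toNat

/-- The orbit, under permutations of the colours, of a pair of states. -/
def stateType (p q : PairState) : ℕ × ℕ × ℕ × Bool × Bool :=
  (colourCount (p.1 &&& ~~~q.1), colourCount (p.1 &&& q.1), colourCount (q.1 &&& ~~~p.1), p.2, q.2)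

/-- The pairs of states that occur at the ends of a single fragment. -/
def SingleRel (p q : PairState) : Prop :=
  stateType p q ∈ [(0, 0, 2, true, false), (0, 0, 2, true, true), (0, 2, 2, false, false),
    (1, 0, 1, true, true), (1, 0, 2, true, true), (1, 1, 1, false, false), (1, 1, 1, false, true),
    (1, 1, 1, true, true), (2, 0, 0, false, true), (2, 0, 0, true, true), (2, 0, 1, false, true),
    (2, 1, 0, false, true), (2, 1, 1, false, true), (2, 2, 0, false, true), (3, 0, 0, false, true)]

/-- The pairs of states that occur at the ends of a sequence of at least two fragments. -/
def CompositeRel (p q : PairState) : Prop :=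
  stateType p q ∈ [(1, 0, 2, true, true), (1, 1, 1, false, true), (2, 0, 1, false, true),
    (2, 1, 0, false, true), (2, 1, 1, false, false), (2, 1, 1, false, true), (3, 0, 0, false, true)]

instance : DecidableRel SingleRel := fun p q => by unfold SingleRel; infer_instance

instance : DecidableRel CompositeRel := fun p q => by unfold CompositeRel; infer_instance

/-- The colour set of the tree edge of a sequence of fragments with the end states `p` and `q`. -/
def treeColour (p q : PairState) : BitVec 4 := ~~~(p.1 ^^^ q.1)

/-- The last two conditions are those at a branch vertex: disjoint tree colours whose union, equal
to their `^^^`, is not everything. Each hypothesis follows the variables it needs, which prunes the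
case check. -/
theorem compositeRel_of_comp_aux : ∀ (p : BitVec 4) (b : Bool) (q : BitVec 4) (c : Bool),
    SingleRel (p, b) (q, c) ∨ CompositeRel (p, b) (q, c) →
    ∀ (r : BitVec 4) (d : Bool), SingleRel (q, c) (r, d) ∨ CompositeRel (q, c) (r, d) →
    treeColour (p, b) (q, c) &&& treeColour (q, c) (r, d) = 0 →
    treeColour (p, b) (q, c) ^^^ treeColour (q, c) (r, d) ≠ BitVec.allOnes 4 →
    CompositeRel (p, b) (r, d) := by
  decide +kernel

theorem compositeRel_of_comp {p q r : PairState} (hpq : SingleRel p q ∨ CompositeRel p q)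
    (hqr : SingleRel q r ∨ CompositeRel q r) (h : treeColour p q &&& treeColour q r = 0)
    (h' : treeColour p q ^^^ treeColour q r ≠ BitVec.allOnes 4) : CompositeRel p r :=
  compositeRel_of_comp_aux p.1 p.2 q.1 q.2 hpq r.1 r.2 hqr h h'

theorem not_singleRel_of_compositeRel_aux : ∀ (p : BitVec 4) (b : Bool) (q : BitVec 4) (c : Bool),
    CompositeRel (p, b) (q, c) → ¬ SingleRel (q, c) (p, b) := by
  decide +kernel

/-- The final contradiction: a run of several fragments cannot be closed into a circuit by one more
fragment. -/
theorem not_singleRel_of_compositeRel {p q : PairState} (h : CompositeRel p q) : ¬ SingleRel q p :=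
  not_singleRel_of_compositeRel_aux p.1 p.2 q.1 q.2 h

/-- The middle state cancels, so the parity formula for `a₃` passes from single fragments to runs.
-/
theorem treeColour_trans (p q r : PairState) :
    ~~~(treeColour p q ^^^ treeColour q r) = treeColour p r := by
  simp only [treeColour]
  have : ∀ x y z : BitVec 4, ~~~(~~~(x ^^^ y) ^^^ ~~~(y ^^^ z)) = ~~~(x ^^^ z) := by decide +kernel
  exact this _ _ _

theorem colourSet_ne_zero {c : Fin 4 → Bool} (h : ∃ i, c i = true) : colourSet c ≠ 0 := by
  have aux : ∀ a b c d : Bool, (a || b || c || d) = true →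
      BitVec.ofNat 4 (a.toNat + 2 * b.toNat + 4 * c.toNat + 8 * d.toNat) ≠ 0 := by decide +kernel
  refine aux _ _ _ _ ?_
  obtain ⟨i, hi⟩ := h
  fin_cases i <;> simp_all

theorem colourSet_partition {x y z : Fin 4 → Bool} (h : ∀ i, exactlyOne (x i) (y i) (z i) = true) :
    colourSet x &&& colourSet y = 0 ∧ colourSet z = ~~~(colourSet x ^^^ colourSet y) := by
  have aux : ∀ x₀ y₀ z₀, exactlyOne x₀ y₀ z₀ = true → ∀ x₁ y₁ z₁, exactlyOne x₁ y₁ z₁ = true →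
      ∀ x₂ y₂ z₂, exactlyOne x₂ y₂ z₂ = true → ∀ x₃ y₃ z₃, exactlyOne x₃ y₃ z₃ = true →
      BitVec.ofNat 4 (x₀.toNat + 2 * x₁.toNat + 4 * x₂.toNat + 8 * x₃.toNat) &&&
        BitVec.ofNat 4 (y₀.toNat + 2 * y₁.toNat + 4 * y₂.toNat + 8 * y₃.toNat) = 0 ∧
      BitVec.ofNat 4 (z₀.toNat + 2 * z₁.toNat + 4 * z₂.toNat + 8 * z₃.toNat) =
        ~~~(BitVec.ofNat 4 (x₀.toNat + 2 * x₁.toNat + 4 * x₂.toNat + 8 * x₃.toNat) ^^^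
          BitVec.ofNat 4 (y₀.toNat + 2 * y₁.toNat + 4 * y₂.toNat + 8 * y₃.toNat)) := by
    decide +kernel
  exact aux _ _ _ (h 0) _ _ _ (h 1) _ _ _ (h 2) _ _ _ (h 3)

/-! ### The perfect matchings of the Petersen fragment

The edges of the fragment are numbered as follows: `0, …, 4` are the half-edges `a₁, …, a₅`, and
`5, …, 18` are the edges joining `1` and `2` to the subdivision vertices, and then those of the
Petersen graph. -/

/-- The set of edges `e` with `f e = true` contains exactly one of the three edges at each vertex of
the fragment. -/
def IsFragmentMatching (f : ℕ → Bool) : Prop :=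
  exactlyOne (f 5) (f 6) (f 2) ∧ exactlyOne (f 5) (f 7) (f 0) ∧ exactlyOne (f 6) (f 8) (f 1) ∧
  exactlyOne (f 7) (f 9) (f 11) ∧ exactlyOne (f 8) (f 17) (f 16) ∧ exactlyOne (f 9) (f 10) (f 12) ∧
  exactlyOne (f 10) (f 13) (f 3) ∧ exactlyOne (f 11) (f 14) (f 15) ∧
  exactlyOne (f 13) (f 15) (f 16) ∧ exactlyOne (f 12) (f 17) (f 18) ∧ exactlyOne (f 14) (f 18) (f 4)

/-- The perfect matchings of the fragment, as sets of edges written in binary. -/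
def fragmentMatchings : List ℕ :=
  [14613, 14640, 29060, 37276, 71711, 71738, 71769, 86158, 86216, 156167, 156194, 156225, 164383,
    164410, 164441, 165014, 165072, 295693, 295720, 296324, 330759, 330786, 330817]

-- A search through the vertices of the fragment, with each condition imposed as soon as its three
-- edges have been chosen.
set_option synthInstance.maxHeartbeats 200000 in
set_option synthInstance.maxSize 1000 in
theorem IsFragmentMatching.exists_mem_aux : ∀ b5 b6 b2, exactlyOne b5 b6 b2 →
    ∀ b7 b0, exactlyOne b5 b7 b0 → ∀ b8 b1, exactlyOne b6 b8 b1 →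
    ∀ b9 b11, exactlyOne b7 b9 b11 → ∀ b17 b16, exactlyOne b8 b17 b16 →
    ∀ b10 b12, exactlyOne b9 b10 b12 → ∀ b13 b3, exactlyOne b10 b13 b3 →
    ∀ b14 b15, exactlyOne b11 b14 b15 → exactlyOne b13 b15 b16 →
    ∀ b18, exactlyOne b12 b17 b18 → ∀ b4, exactlyOne b14 b18 b4 →
    ∃ m ∈ fragmentMatchings, [b0, b1, b2, b3, b4, b5, b6, b7, b8, b9, b10, b11, b12, b13, b14, b15,
      b16, b17, b18] = (List.range 19).map m.testBit := by
  decide +kernel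

theorem IsFragmentMatching.exists_mem {f : ℕ → Bool} (h : IsFragmentMatching f) :
    ∃ m ∈ fragmentMatchings, ∀ e < 19, f e = m.testBit e := by
  obtain ⟨h1, h2, h3, h4, h5, h6, h7, h8, h9, h10, h11⟩ := h
  obtain ⟨m, hm, h⟩ := IsFragmentMatching.exists_mem_aux _ _ _ h1 _ _ h2 _ _ h3 _ _ h4 _ _ h5 _ _ h6
    _ _ h7 _ _ h8 h9 _ h10 _ h11
  simp only [List.range, List.range.loop, List.map_cons, List.map_nil, List.cons.injEq] at h
  refine ⟨m, hm, fun e he => ?_⟩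
  interval_cases e <;> simp only [h]

/-- The colour set of the edge `e`, where the colour classes are `a`, `b`, `c`, `d`. -/
def edgeColour (a b c d e : ℕ) : BitVec 4 :=
  colourSet ![a.testBit e, b.testBit e, c.testBit e, d.testBit e]

def fragmentCheck (a b c d : ℕ) : Bool :=
  decide (SingleRel (pairState (edgeColour a b c d 0) (edgeColour a b c d 1))
      (pairState (edgeColour a b c d 3) (edgeColour a b c d 4)) ∧
    edgeColour a b c d 2 =
      treeColour (pairState (edgeColour a b c d 0) (edgeColour a b c d 1))
        (pairState (edgeColour a b c d 3) (edgeColour a b c d 4)))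

/-- Both the covering condition and the conclusion are invariant under permuting the colours, so
quadruples in increasing order suffice. The number `524287 = 2 ^ 19 - 1` is the set of all 19 edges.
-/
theorem fragmentCheck_of_cover_aux :
    (fragmentMatchings.all fun a => fragmentMatchings.all fun b => !Nat.ble a b ||
      fragmentMatchings.all fun c => !Nat.ble b c || fragmentMatchings.all fun d =>
        !(Nat.ble c d && Nat.beq (Nat.lor (Nat.lor (Nat.lor a b) c) d) 524287) ||
          fragmentCheck a b c d) = true := by
  decide +kernel

theorem fragmentMatchings_lt : ∀ m ∈ fragmentMatchings, m < 2 ^ 19 := by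
  decide +kernel

/-! ### Invariance under permutations of the colours -/

theorem colourSet_and (x y : Fin 4 → Bool) :
    colourSet x &&& colourSet y = colourSet fun i => x i && y i := by
  have aux : ∀ a b c d a' b' c' d' : Bool,
      BitVec.ofNat 4 (a.toNat + 2 * b.toNat + 4 * c.toNat + 8 * d.toNat) &&&
        BitVec.ofNat 4 (a'.toNat + 2 * b'.toNat + 4 * c'.toNat + 8 * d'.toNat) =
      BitVec.ofNat 4 ((a && a').toNat + 2 * (b && b').toNat + 4 * (c && c').toNat +
        8 * (d && d').toNat) := by decide +kernel
  exact aux _ _ _ _ _ _ _ _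

theorem colourSet_xor (x y : Fin 4 → Bool) :
    colourSet x ^^^ colourSet y = colourSet fun i => x i ^^ y i := by
  have aux : ∀ a b c d a' b' c' d' : Bool,
      BitVec.ofNat 4 (a.toNat + 2 * b.toNat + 4 * c.toNat + 8 * d.toNat) ^^^
        BitVec.ofNat 4 (a'.toNat + 2 * b'.toNat + 4 * c'.toNat + 8 * d'.toNat) =
      BitVec.ofNat 4 ((a ^^ a').toNat + 2 * (b ^^ b').toNat + 4 * (c ^^ c').toNat +
        8 * (d ^^ d').toNat) := by decide +kernel
  exact aux _ _ _ _ _ _ _ _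

theorem colourSet_not (x : Fin 4 → Bool) : ~~~colourSet x = colourSet fun i => !x i := by
  have aux : ∀ a b c d : Bool,
      ~~~BitVec.ofNat 4 (a.toNat + 2 * b.toNat + 4 * c.toNat + 8 * d.toNat) =
      BitVec.ofNat 4 ((!a).toNat + 2 * (!b).toNat + 4 * (!c).toNat + 8 * (!d).toNat) := by
    decide +kernel
  exact aux _ _ _ _

theorem colourSet_injective : Function.Injective colourSet := by
  have aux : ∀ a b c d a' b' c' d' : Bool,
      BitVec.ofNat 4 (a.toNat + 2 * b.toNat + 4 * c.toNat + 8 * d.toNat) =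
        BitVec.ofNat 4 (a'.toNat + 2 * b'.toNat + 4 * c'.toNat + 8 * d'.toNat) →
      a = a' ∧ b = b' ∧ c = c' ∧ d = d' := by decide +kernel
  intro x y h
  obtain ⟨h0, h1, h2, h3⟩ := aux _ _ _ _ _ _ _ _ h
  funext i
  fin_cases i <;> assumption

theorem colourCount_colourSet (x : Fin 4 → Bool) : colourCount (colourSet x) = ∑ i, (x i).toNat := by
  have aux : ∀ a b c d : Bool,
      colourCount (BitVec.ofNat 4 (a.toNat + 2 * b.toNat + 4 * c.toNat + 8 * d.toNat)) =
        a.toNat + b.toNat + c.toNat + d.toNat := by decide +kernel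
  rw [Fin.sum_univ_four]
  exact aux _ _ _ _

theorem colourCount_colourSet_comp (σ : Equiv.Perm (Fin 4)) (x : Fin 4 → Bool) :
    colourCount (colourSet fun i => x (σ i)) = colourCount (colourSet x) := by
  rw [colourCount_colourSet, colourCount_colourSet]
  exact Equiv.sum_comp σ fun i => (x i).toNat

theorem colourSet_bne_zero_comp (σ : Equiv.Perm (Fin 4)) (x : Fin 4 → Bool) :
    (colourSet (fun i => x (σ i)) != 0) = (colourSet x != 0) := by
  have aux : ∀ y : BitVec 4, (y != 0) = decide (colourCount y ≠ 0) := by decide +kernel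
  rw [aux, aux, colourCount_colourSet_comp]

/-- The colouring of a fragment in which the edge `e` has the colours `i` with `f i e = true` has
related end states, and these determine the colour set of the half-edge `a₃`. -/
def FragmentStates (f : Fin 4 → ℕ → Bool) : Prop :=
  SingleRel (pairState (colourSet (f · 0)) (colourSet (f · 1)))
      (pairState (colourSet (f · 3)) (colourSet (f · 4))) ∧
    colourSet (f · 2) = treeColour (pairState (colourSet (f · 0)) (colourSet (f · 1)))
      (pairState (colourSet (f · 3)) (colourSet (f · 4)))

/-- `SingleRel` depends only on sizes of colour sets and on whether they are empty, and the formula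
for `a₃` holds colour by colour. -/
theorem FragmentStates.of_comp (σ : Equiv.Perm (Fin 4)) {f : Fin 4 → ℕ → Bool}
    (h : FragmentStates fun i => f (σ i)) : FragmentStates f := by
  obtain ⟨h1, h2⟩ := h
  constructor
  · simp only [SingleRel, stateType, pairState, colourSet_and, colourSet_xor, colourSet_not] at h1 ⊢
    have h3 (x : Fin 4 → Bool) := colourCount_colourSet_comp σ x
    have h4 (x : Fin 4 → Bool) := colourSet_bne_zero_comp σ x
    rw [h3 fun i => (f i 0 ^^ f i 1) && !(f i 3 ^^ f i 4),
      h3 fun i => (f i 0 ^^ f i 1) && (f i 3 ^^ f i 4),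
      h3 fun i => (f i 3 ^^ f i 4) && !(f i 0 ^^ f i 1), h4 fun i => f i 0 && f i 1,
      h4 fun i => f i 3 && f i 4] at h1
    exact h1
  · simp only [treeColour, pairState, colourSet_xor, colourSet_not] at h2 ⊢
    have := colourSet_injective h2
    congr 1
    funext i
    simpa using congrFun this (σ.symm i)

/-- The four colour classes of a cover of the fragment by perfect matchings determine states that
are related by `SingleRel`. -/
theorem fragmentStates_of_cover {f : Fin 4 → ℕ → Bool} (hf : ∀ i, IsFragmentMatching (f i))
    (hcov : ∀ e < 19, ∃ i, f i e = true) : FragmentStates f := by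
  choose m' hm' hfm' using fun i => (hf i).exists_mem
  -- Renumber the colours so that the codes of the four matchings increase, as the finite check
  -- requires.
  set σ := Tuple.sort m'
  apply FragmentStates.of_comp σ
  have hm (i) := hm' (σ i)
  have hfm (i) := hfm' (σ i)
  have hmono : Monotone fun i => m' (σ i) := Tuple.monotone_sort m'
  replace hcov : ∀ e < 19, ∃ i, f (σ i) e = true := fun e he =>
    let ⟨i, hi⟩ := hcov e he
    ⟨σ.symm i, by simpa using hi⟩
  generalize hmdef : (fun i => m' (σ i)) = m at hmono
  have hmi : ∀ i, m' (σ i) = m i := congrFun hmdef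
  simp only [hmi] at hm hfm
  have hor : Nat.lor (Nat.lor (Nat.lor (m 0) (m 1)) (m 2)) (m 3) = 524287 := by
    change (m 0 ||| m 1 ||| m 2 ||| m 3) = 2 ^ 19 - 1
    apply Nat.eq_of_testBit_eq
    intro e
    rw [Nat.testBit_two_pow_sub_one]
    simp only [Nat.testBit_or]
    by_cases he : e < 19
    · obtain ⟨i, hi⟩ := hcov e he
      rw [hfm i e he] at hi
      simp only [he, decide_true]
      fin_cases i <;> simp_all
    -- Codes of matchings have no bits from position 19 on.
    · have hlt : ∀ i, (m i).testBit e = false := fun i =>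
        Nat.testBit_lt_two_pow ((fragmentMatchings_lt _ (hm i)).trans_le
          (Nat.pow_le_pow_right (by norm_num) (not_lt.1 he)))
      simp [hlt, he]
  have h01 : Nat.ble (m 0) (m 1) = true := Nat.ble_eq_true_of_le (hmono (by decide))
  have h12 : Nat.ble (m 1) (m 2) = true := Nat.ble_eq_true_of_le (hmono (by decide))
  have h23 : Nat.ble (m 2) (m 3) = true := Nat.ble_eq_true_of_le (hmono (by decide))
  have key := List.all_eq_true.1 (List.all_eq_true.1 fragmentCheck_of_cover_aux _ (hm 0)) _ (hm 1)
  rw [h01, Bool.not_true, Bool.false_or] at key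
  have key := List.all_eq_true.1 key _ (hm 2)
  rw [h12, Bool.not_true, Bool.false_or] at key
  have key := List.all_eq_true.1 key _ (hm 3)
  rw [h23, hor, Bool.true_and, Nat.beq_refl, Bool.not_true, Bool.false_or] at key
  have hcol : ∀ e < 19, edgeColour (m 0) (m 1) (m 2) (m 3) e = colourSet fun i => f (σ i) e := by
    intro e he
    simp [edgeColour, colourSet, hfm _ e he]
  rw [fragmentCheck, decide_eq_true_iff] at key
  rw [hcol 0 (by norm_num), hcol 1 (by norm_num), hcol 2 (by norm_num), hcol 3 (by norm_num),
    hcol 4 (by norm_num)] at key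
  exact key

/-! ### Walking around the tree -/

namespace CubicHalinGraph

variable {V : Type*} (H : CubicHalinGraph V)

/-- The leaf `a` is the first leaf met on the walk around the tree that starts with the dart `d`. -/
def FirstLeaf (d : H.tree.Dart) (a : {v : V // IsLeafOf H.tree v}) : Prop :=
  ∃ n : ℕ, ((contourStep H.rot)^[n] d).snd = a.val ∧
    ∀ m < n, ¬ IsLeafOf H.tree ((contourStep H.rot)^[m] d).snd

/-- The leaf `b` is the last leaf met on the walk around the tree before it traverses the reverse of
the dart `d`. -/
def LastLeaf (d : H.tree.Dart) (b : {v : V // IsLeafOf H.tree v}) : Prop :=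
  ∃ e : H.tree.Dart, e.fst = b.val ∧ ∃ n : ℕ, (contourStep H.rot)^[n] e = d.symm ∧
    ∀ m < n, ¬ IsLeafOf H.tree ((contourStep H.rot)^[m] e).snd

variable {H}

theorem FirstLeaf.unique {d : H.tree.Dart} {a b : {v : V // IsLeafOf H.tree v}}
    (ha : H.FirstLeaf d a) (hb : H.FirstLeaf d b) : a = b := by
  obtain ⟨n, hn, hn'⟩ := ha
  obtain ⟨m, hm, hm'⟩ := hb
  have hnm : n = m := by
    rcases lt_trichotomy n m with h | h | h
    · exact absurd (hn ▸ a.2) (hm' n h)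
    · exact h
    · exact absurd (hm ▸ b.2) (hn' m h)
  subst hnm
  exact Subtype.ext (hn.symm.trans hm)

theorem firstLeaf_of_isLeafOf {d : H.tree.Dart} (h : IsLeafOf H.tree d.snd) :
    H.FirstLeaf d ⟨d.snd, h⟩ :=
  ⟨0, rfl, by simp⟩

theorem lastLeaf_of_isLeafOf {d : H.tree.Dart} (h : IsLeafOf H.tree d.snd) :
    H.LastLeaf d ⟨d.snd, h⟩ :=
  ⟨d.symm, rfl, 0, rfl, by simp⟩

theorem FirstLeaf.of_contourStep {d : H.tree.Dart} {a : {v : V // IsLeafOf H.tree v}}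
    (hd : ¬ IsLeafOf H.tree d.snd) (ha : H.FirstLeaf (contourStep H.rot d) a) :
    H.FirstLeaf d a := by
  obtain ⟨n, hn, hn'⟩ := ha
  refine ⟨n + 1, hn, fun m hm => ?_⟩
  cases m with
  | zero => exact hd
  | succ m => exact hn' m (by omega)

/-- The walk returns from the subtree beyond `d` to a branch vertex and leaves it at once by the
reverse of `d'`, so no leaf comes in between. -/
theorem LastLeaf.of_contourStep {d d' : H.tree.Dart} {b : {v : V // IsLeafOf H.tree v}}
    (hd : ¬ IsLeafOf H.tree d.fst) (hb : H.LastLeaf d b) (h : contourStep H.rot d.symm = d'.symm) :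
    H.LastLeaf d' b := by
  obtain ⟨e, he, n, hn, hn'⟩ := hb
  refine ⟨e, he, n + 1, by rw [Function.iterate_succ_apply', hn, h], fun m hm => ?_⟩
  rcases Nat.lt_succ_iff_lt_or_eq.1 hm with hm | rfl
  · exact hn' m hm
  · rw [hn]; exact hd

/-- The walk from `b` to the reverse of `d` and the walk on from there to `a` concatenate to a walk
that meets no leaf before `a`. -/
theorem LastLeaf.next_eq {d : H.tree.Dart} {b a : {v : V // IsLeafOf H.tree v}}
    (hb : H.LastLeaf d b) (ha : H.FirstLeaf d.symm a) : H.next b = a := by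
  obtain ⟨e, he, n, hn, hn'⟩ := hb
  obtain ⟨k, hk, hk'⟩ := ha
  refine FirstLeaf.unique (H.next_contour b e he) ⟨k + n, ?_, fun m hm => ?_⟩
  · rw [Function.iterate_add_apply, hn, hk]
  · by_cases h : m < n
    · exact hn' m h
    · obtain ⟨j, rfl⟩ := Nat.exists_eq_add_of_le' (not_lt.1 h)
      rw [Function.iterate_add_apply, hn]
      exact hk' j (by omega)

/-- The darts leaving a vertex of degree three. -/
theorem rot_of_degree_eq_three [Finite V] (d : H.tree.Dart)
    (h : (H.tree.neighborSet d.fst).ncard = 3) :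
    (H.rot (H.rot (H.rot d))) = d ∧ d ≠ H.rot d ∧ d ≠ H.rot (H.rot d) ∧ H.rot d ≠ H.rot (H.rot d) ∧
      ∀ e : H.tree.Dart, e.fst = d.fst → e = d ∨ e = H.rot d ∨ e = H.rot (H.rot d) := by
  classical
  have := Fintype.ofFinite V
  set s : Finset H.tree.Dart := Finset.univ.filter fun e => e.fst = d.fst with hs
  have hcard : s.card = 3 := by
    rw [← h, Set.ncard_eq_toFinset_card']
    convert SimpleGraph.dart_fst_fiber_card_eq_degree H.tree d.fst
    rfl
  have hcyc : H.rot.IsCycleOn s := by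
    refine ⟨⟨fun e he => ?_, H.rot.injective.injOn, fun e he => ?_⟩, fun e he e' he' => ?_⟩
    · simpa [hs, H.isRotationSystem.fst_eq] using he
    · refine ⟨H.rot.symm e, ?_, by simp⟩
      have := H.isRotationSystem.fst_eq (H.rot.symm e)
      simp only [Equiv.apply_symm_apply] at this
      simpa [hs, ← this] using he
    · refine H.isRotationSystem.sameCycle e e' ?_
      simp only [hs, Finset.coe_filter, Finset.mem_univ, true_and, Set.mem_ofPred_eq] at he he'
      rw [he, he']
  have hd : d ∈ s := by simp [hs]
  have hall : ∀ e : H.tree.Dart, e.fst = d.fst → e = d ∨ e = H.rot d ∨ e = H.rot (H.rot d) := by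
    intro e he
    obtain ⟨n, hn, rfl⟩ := hcyc.exists_pow_eq hd (b := e) (by simpa [hs] using he)
    rw [hcard] at hn
    interval_cases n
    · simp
    · simp
    · right; right; rfl
  have hpow := hcyc.pow_card_apply hd
  rw [hcard] at hpow
  -- The three images of `d` exhaust a set of three darts, so no two of them coincide.
  have hsub : s ⊆ {d, H.rot d, H.rot (H.rot d)} := fun e he => by
    simpa using hall e (by simpa [hs] using he)
  have hle := Finset.card_le_card hsub
  rw [hcard] at hle
  have hpair : ∀ x y : H.tree.Dart, ({x, y} : Finset H.tree.Dart).card < 3 := fun x y =>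
    (Finset.card_le_two).trans_lt (by norm_num)
  refine ⟨hpow, fun h => ?_, fun h => ?_, fun h => ?_, hall⟩
  · refine absurd hle (not_le.2 ?_)
    rw [← h, Finset.insert_eq_of_mem (by simp)]
    exact hpair _ _
  · refine absurd hle (not_le.2 ?_)
    rw [← h, Finset.insert_eq_of_mem (by simp)]
    exact hpair _ _
  · refine absurd hle (not_le.2 ?_)
    rw [← h, Finset.pair_eq_singleton]
    exact hpair _ _

/-! ### Leaves, and induction over the tree -/

theorem eq_of_adj_isLeafOf {v u w : V} (hv : IsLeafOf H.tree v) (hu : H.tree.Adj v u)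
    (hw : H.tree.Adj v w) : w = u := by
  obtain ⟨x, hx⟩ := Set.ncard_eq_one.1 hv
  have hu' : u ∈ H.tree.neighborSet v := hu
  have hw' : w ∈ H.tree.neighborSet v := hw
  rw [hx, Set.mem_singleton_iff] at hu' hw'
  rw [hu', hw']

theorem exists_adj_of_isLeafOf {v : V} (hv : IsLeafOf H.tree v) : ∃ u, H.tree.Adj v u := by
  obtain ⟨x, hx⟩ := Set.ncard_eq_one.1 hv
  exact ⟨x, by rw [← SimpleGraph.mem_neighborSet, hx]; rfl⟩

/-- As the tree is not a single edge, no two leaves are adjacent. -/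
theorem not_isLeafOf_of_adj {v u : V} (hv : IsLeafOf H.tree v) (hvu : H.tree.Adj v u) :
    ¬ IsLeafOf H.tree u := by
  intro hu
  -- Two adjacent leaves would form a whole component, which leaves no room for a vertex of degree
  -- three.
  have key : ∀ {a b : V} (_ : H.tree.Walk a b), (a = v ∨ a = u) → b = v ∨ b = u := by
    intro a b p
    induction p with
    | nil => exact id
    | cons h p ih =>
      rintro (rfl | rfl)
      · exact ih (Or.inr (eq_of_adj_isLeafOf hv hvu h))
      · exact ih (Or.inl (eq_of_adj_isLeafOf hu hvu.symm h))
  obtain ⟨w, hw⟩ := H.exists_degree_eq_three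
  obtain ⟨p⟩ := H.isTree.connected.preconnected v w
  unfold IsLeafOf at hv hu
  rcases key p (Or.inl rfl) with rfl | rfl <;> omega

theorem degree_eq_three_of_not_isLeafOf {v : V} (hv : ¬ IsLeafOf H.tree v) :
    (H.tree.neighborSet v).ncard = 3 :=
  (H.degree_eq v).resolve_left hv

theorem exists_isLeafOf [Finite V] : ∃ v, IsLeafOf H.tree v := by
  classical
  have := Fintype.ofFinite V
  obtain ⟨w, hw⟩ := H.exists_degree_eq_three
  obtain ⟨x, hx⟩ : (H.tree.neighborSet w).Nonempty := by
    rw [← Set.ncard_pos]; omega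
  have : Nontrivial V := ⟨w, x, SimpleGraph.Adj.ne hx⟩
  obtain ⟨v, hv⟩ := H.isTree.exists_vert_degree_one_of_nontrivial
  refine ⟨v, ?_⟩
  rw [IsLeafOf, Set.ncard_eq_toFinset_card', ← hv, SimpleGraph.degree]
  rfl

/-- In a tree, a path whose end is extended by one edge can be extended further by any edge that
does not lead back. -/
theorem notMem_support_concat {G : SimpleGraph V} (hG : G.IsAcyclic) {r u v w : V}
    {p : G.Walk r u} (hp : p.IsPath) (huv : G.Adj u v) (hv : v ∉ p.support) (hvw : G.Adj v w)
    (hwu : w ≠ u) : w ∉ (p.concat huv).support := by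
  classical
  rw [SimpleGraph.Walk.support_concat, List.mem_append, List.mem_singleton]
  rintro (hw | rfl)
  -- If `w` were on `p`, the tree would have two paths from `w` to `v`: along `p` through `u`, and
  -- the single edge. Equal lengths force `w = u`.
  · have hq : ((p.dropUntil w hw).concat huv).IsPath :=
      (hp.dropUntil hw).concat (fun h => hv (p.support_dropUntil_subset_support hw h)) huv
    have hs : (SimpleGraph.Walk.cons hvw.symm SimpleGraph.Walk.nil).IsPath := by
      simp [hvw.ne']
    have heq := congrArg (fun p : G.Path w v => p.val.length)
      ((hG.subsingleton_path w v).elim ⟨_, hq⟩ ⟨_, hs⟩)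
    simp only [SimpleGraph.Walk.length_concat, SimpleGraph.Walk.length_cons,
      SimpleGraph.Walk.length_nil] at heq
    exact hwu (SimpleGraph.Walk.eq_of_length_eq_zero (p := p.dropUntil w hw) (by omega))
  · exact hvw.ne rfl

/-- Induction over the darts that lead away from a vertex `r` of the tree. -/
theorem dart_induction [Finite V] (r : V) {P : H.tree.Dart → Prop}
    (leaf : ∀ d : H.tree.Dart, IsLeafOf H.tree d.snd → P d)
    (branch : ∀ d : H.tree.Dart, ¬ IsLeafOf H.tree d.snd → P (H.rot d.symm) →
      P (H.rot (H.rot d.symm)) → P d)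
    (d : H.tree.Dart) (hd : d.fst = r) : P d := by
  have := Fintype.ofFinite V
  -- The path from `r` to the dart grows at each branch, and its length stays below the number of
  -- vertices; `n` bounds the remaining room.
  suffices h : ∀ (n : ℕ) (d : H.tree.Dart) (p : H.tree.Walk r d.fst), p.IsPath →
      d.snd ∉ p.support → Fintype.card V ≤ p.length + n → P d by
    subst hd
    exact h _ d SimpleGraph.Walk.nil SimpleGraph.Walk.IsPath.nil
      (by simp [d.adj.ne']) (Nat.le_add_left _ _)
  intro n
  induction n with
  | zero => exact fun d p hp _ hn => absurd hp.length_lt (by omega)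
  | succ n ih =>
    intro d p hp hd hn
    by_cases hleaf : IsLeafOf H.tree d.snd
    · exact leaf d hleaf
    obtain ⟨-, h1, h2, -, -⟩ := rot_of_degree_eq_three d.symm
      (degree_eq_three_of_not_isLeafOf hleaf)
    have key : ∀ e : H.tree.Dart, e.fst = d.snd → d.symm ≠ e → P e := by
      rintro ⟨⟨e, w⟩, he⟩ rfl hne
      refine ih _ (p.concat d.adj) (hp.concat hd d.adj)
        (notMem_support_concat H.isTree.isAcyclic hp d.adj hd he fun hw => ?_)
        (by rw [SimpleGraph.Walk.length_concat]; omega)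
      exact hne (SimpleGraph.Dart.ext _ _ (Prod.ext rfl hw.symm))
    exact branch d hleaf (key _ (H.isRotationSystem.fst_eq _) h1)
      (key _ ((H.isRotationSystem.fst_eq _).trans (H.isRotationSystem.fst_eq _)) h2)

end CubicHalinGraph

/-! ### Neighbours and colours in the treelike snark -/

/-- A perfect matching contains exactly one of the three edges at a vertex. -/
theorem exactlyOne_of_isPerfectMatching {W : Type*} {G : SimpleGraph W} {M : G.Subgraph}
    (hM : M.IsPerfectMatching) {v a b c : W} (h : ∀ w, G.Adj v w → w = a ∨ w = b ∨ w = c)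
    (hab : a ≠ b) (hac : a ≠ c) (hbc : b ≠ c) [Decidable (M.Adj v a)] [Decidable (M.Adj v b)]
    [Decidable (M.Adj v c)] :
    exactlyOne (decide (M.Adj v a)) (decide (M.Adj v b)) (decide (M.Adj v c)) = true := by
  obtain ⟨w, hw, huniq⟩ := SimpleGraph.Subgraph.isPerfectMatching_iff.1 hM v
  have heq : ∀ x, M.Adj v x ↔ x = w := fun x => ⟨fun hx => huniq x hx, fun hx => hx ▸ hw⟩
  rcases h w hw.adj_sub with rfl | rfl | rfl
  · simp [exactlyOne, heq, hab.symm, hac.symm]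
  · simp [exactlyOne, heq, hab, hbc.symm]
  · simp [exactlyOne, heq, hac, hbc]

namespace CubicHalinGraph

variable {V : Type*} {H : CubicHalinGraph V}

open Classical in
/-- The vertex of the snark at which an edge of the tree with the end `v` ends. -/
noncomputable def attachPoint (H : CubicHalinGraph V) (v : V) : H.SnarkVertex :=
  if h : IsLeafOf H.tree v then .inr (⟨v, h⟩, petersenFragment.spoke 2) else .inl ⟨v, h⟩

theorem attachPoint_of_isLeafOf {v : V} (h : IsLeafOf H.tree v) :
    H.attachPoint v = .inr (⟨v, h⟩, petersenFragment.spoke 2) := dif_pos h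

theorem attachPoint_of_not_isLeafOf {v : V} (h : ¬ IsLeafOf H.tree v) :
    H.attachPoint v = .inl ⟨v, h⟩ := dif_neg h

theorem attachPoint_injective : Function.Injective H.attachPoint := by
  intro u v h
  by_cases hu : IsLeafOf H.tree u <;> by_cases hv : IsLeafOf H.tree v <;>
    simp_all [attachPoint]

theorem treelikeSnark_adj_inl {v : {v : V // ¬ IsLeafOf H.tree v}} {w : H.SnarkVertex} :
    H.treelikeSnark.Adj (.inl v) w ↔ ∃ u, H.tree.Adj v u ∧ w = H.attachPoint u := by
  rw [treelikeSnark, SimpleGraph.fromRel_adj]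
  rcases w with w | ⟨ℓ, p⟩
  · simp only [snarkRel]
    constructor
    · rintro ⟨-, h | h⟩
      · exact ⟨w, h, (attachPoint_of_not_isLeafOf w.2).symm⟩
      · exact ⟨w, h.symm, (attachPoint_of_not_isLeafOf w.2).symm⟩
    · rintro ⟨u, hu, hw⟩
      obtain rfl : w.val = u := attachPoint_injective
        ((attachPoint_of_not_isLeafOf w.2).trans hw)
      refine ⟨fun h => hu.ne ?_, Or.inl hu⟩
      rw [Sum.inl.inj h]
  · simp only [snarkRel, or_false]
    constructor
    · rintro ⟨-, h, rfl⟩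
      exact ⟨ℓ, h, (attachPoint_of_isLeafOf ℓ.2).symm⟩
    · rintro ⟨u, hu, hw⟩
      have hleaf : IsLeafOf H.tree u := by
        by_contra hu'
        rw [attachPoint_of_not_isLeafOf hu'] at hw
        cases hw
      rw [attachPoint_of_isLeafOf hleaf] at hw
      cases hw
      exact ⟨by simp, hu, rfl⟩

/-- The other end of an edge of the snark incident with a vertex of the fragment of `ℓ`: it is
either a vertex of the same fragment, or the other end of the edge that contains a given
half-edge; here `u` is the neighbour of `ℓ` in the tree. -/
noncomputable def fragmentTarget (ℓ : {v : V // IsLeafOf H.tree v}) (u : V) :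
    PetersenFragmentVertex ⊕ Fin 5 → H.SnarkVertex
  | .inl q => .inr (ℓ, q)
  | .inr 0 => .inr (H.next.symm ℓ, petersenFragment.spoke 4)
  | .inr 1 => .inr (H.next.symm ℓ, petersenFragment.spoke 3)
  | .inr 2 => H.attachPoint u
  | .inr 3 => .inr (H.next ℓ, petersenFragment.spoke 1)
  | .inr 4 => .inr (H.next ℓ, petersenFragment.spoke 0)

/-- The position of `fragmentTarget` in the fragment that contains it. -/
def targetPosition : PetersenFragmentVertex ⊕ Fin 5 → Option PetersenFragmentVertex
  | .inl q => some q
  | .inr i => ![some (petersenFragmentSpoke 4), some (petersenFragmentSpoke 3), none,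
      some (petersenFragmentSpoke 1), some (petersenFragmentSpoke 0)] i

/-- Positions inside the fragments already separate the targets, so it does not matter whether the
leaves `ℓ`, `H.next ℓ` and `H.next.symm ℓ` coincide. -/
theorem fragmentTarget_ne {ℓ : {v : V // IsLeafOf H.tree v}} {u : V} (hu : H.tree.Adj ℓ u)
    {x y : PetersenFragmentVertex ⊕ Fin 5} (h : targetPosition x ≠ targetPosition y) :
    fragmentTarget ℓ u x ≠ fragmentTarget ℓ u y := by
  have key : ∀ x, Sum.elim (fun _ => none) (fun z => some z.2) (fragmentTarget ℓ u x) =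
      targetPosition x := by
    rintro (q | i)
    · rfl
    · fin_cases i
      · rfl
      · rfl
      · change Sum.elim _ _ (H.attachPoint u) = _
        rw [attachPoint_of_not_isLeafOf (not_isLeafOf_of_adj ℓ.2 hu)]
        rfl
      · rfl
      · rfl
  intro heq
  rw [← key x, ← key y, heq] at h
  exact h rfl

theorem treelikeSnark_adj_inr {ℓ : {v : V // IsLeafOf H.tree v}} {u : V} (hu : H.tree.Adj ℓ u)
    {p : PetersenFragmentVertex} {w : H.SnarkVertex} (h : H.treelikeSnark.Adj (.inr (ℓ, p)) w) :
    (∃ q, petersenFragmentGraph.Adj p q ∧ w = fragmentTarget ℓ u (.inl q)) ∨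
      ∃ i, petersenFragmentSpoke i = p ∧ w = fragmentTarget ℓ u (.inr i) := by
  rcases w with v | ⟨ℓ', q⟩
  · obtain ⟨u', hu', hw⟩ := treelikeSnark_adj_inl.1 h.symm
    have hleaf : IsLeafOf H.tree u' := by
      by_contra hu''
      rw [attachPoint_of_not_isLeafOf hu''] at hw
      cases hw
    rw [attachPoint_of_isLeafOf hleaf] at hw
    cases hw
    refine Or.inr ⟨2, rfl, ?_⟩
    obtain rfl := eq_of_adj_isLeafOf hleaf hu hu'.symm
    exact (attachPoint_of_not_isLeafOf v.2).symm
  · rw [treelikeSnark, SimpleGraph.fromRel_adj] at h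
    obtain ⟨-, (⟨rfl, h⟩ | ⟨rfl, ⟨rfl, rfl⟩ | ⟨rfl, rfl⟩⟩) | (⟨rfl, h⟩ | ⟨rfl, ⟨rfl, rfl⟩ | ⟨rfl, rfl⟩⟩)⟩
      := h
    · exact Or.inl ⟨q, h, rfl⟩
    · exact Or.inr ⟨3, rfl, rfl⟩
    · exact Or.inr ⟨4, rfl, rfl⟩
    · exact Or.inl ⟨q, h.symm, rfl⟩
    · exact Or.inr ⟨1, rfl, by simp [fragmentTarget]⟩
    · exact Or.inr ⟨0, rfl, by simp [fragmentTarget]⟩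

theorem treelikeSnark_adj_inl_target (ℓ : {v : V // IsLeafOf H.tree v}) (u : V)
    {p q : PetersenFragmentVertex} (h : petersenFragmentGraph.Adj p q) :
    H.treelikeSnark.Adj (.inr (ℓ, p)) (fragmentTarget ℓ u (.inl q)) := by
  rw [treelikeSnark, SimpleGraph.fromRel_adj]
  refine ⟨fun heq => h.ne ?_, Or.inl (Or.inl ⟨rfl, h⟩)⟩
  simpa [fragmentTarget] using heq

theorem treelikeSnark_adj_next (ℓ : {v : V // IsLeafOf H.tree v}) :
    H.treelikeSnark.Adj (.inr (ℓ, petersenFragment.spoke 3))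
        (.inr (H.next ℓ, petersenFragment.spoke 1)) ∧
      H.treelikeSnark.Adj (.inr (ℓ, petersenFragment.spoke 4))
        (.inr (H.next ℓ, petersenFragment.spoke 0)) := by
  have h1 : petersenFragment.spoke 3 ≠ petersenFragment.spoke 1 := by
    change petersenFragmentSpoke 3 ≠ petersenFragmentSpoke 1
    decide
  have h2 : petersenFragment.spoke 4 ≠ petersenFragment.spoke 0 := by
    change petersenFragmentSpoke 4 ≠ petersenFragmentSpoke 0
    decide
  simp only [treelikeSnark, SimpleGraph.fromRel_adj]
  exact ⟨⟨fun h => h1 (congrArg Prod.snd (Sum.inr.inj h)),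
      Or.inl (Or.inr ⟨rfl, Or.inl ⟨rfl, rfl⟩⟩)⟩,
    ⟨fun h => h2 (congrArg Prod.snd (Sum.inr.inj h)), Or.inl (Or.inr ⟨rfl, Or.inr ⟨rfl, rfl⟩⟩)⟩⟩

theorem treelikeSnark_adj_attachPoint {u v : V} (h : H.tree.Adj u v) :
    H.treelikeSnark.Adj (H.attachPoint u) (H.attachPoint v) := by
  by_cases hu : IsLeafOf H.tree u
  · rw [attachPoint_of_not_isLeafOf (not_isLeafOf_of_adj hu h)]
    exact (treelikeSnark_adj_inl.2 ⟨u, h.symm, rfl⟩).symm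
  · rw [attachPoint_of_not_isLeafOf hu]
    exact treelikeSnark_adj_inl.2 ⟨v, h, rfl⟩

theorem treelikeSnark_adj_inr_target (ℓ : {v : V // IsLeafOf H.tree v}) {u : V}
    (hu : H.tree.Adj ℓ u) (i : Fin 5) :
    H.treelikeSnark.Adj (.inr (ℓ, petersenFragmentSpoke i)) (fragmentTarget ℓ u (.inr i)) := by
  have hprev := treelikeSnark_adj_next (H.next.symm ℓ)
  rw [Equiv.apply_symm_apply] at hprev
  fin_cases i
  · exact hprev.2.symm
  · exact hprev.1.symm
  · have := treelikeSnark_adj_attachPoint hu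
    rwa [attachPoint_of_isLeafOf ℓ.2] at this
  · exact (treelikeSnark_adj_next ℓ).1
  · exact (treelikeSnark_adj_next ℓ).2

theorem exactlyOne_fragment {M : H.treelikeSnark.Subgraph} (hM : M.IsPerfectMatching)
    [DecidableRel M.Adj] {ℓ : {v : V // IsLeafOf H.tree v}} {u : V} (hu : H.tree.Adj ℓ u)
    (p : PetersenFragmentVertex) (x y z : PetersenFragmentVertex ⊕ Fin 5)
    (h : (∀ q, petersenFragmentGraph.Adj p q → .inl q = x ∨ .inl q = y ∨ .inl q = z) ∧
      (∀ i, petersenFragmentSpoke i = p → .inr i = x ∨ .inr i = y ∨ .inr i = z) ∧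
      targetPosition x ≠ targetPosition y ∧ targetPosition x ≠ targetPosition z ∧
      targetPosition y ≠ targetPosition z) :
    exactlyOne (decide (M.Adj (.inr (ℓ, p)) (fragmentTarget ℓ u x)))
      (decide (M.Adj (.inr (ℓ, p)) (fragmentTarget ℓ u y)))
      (decide (M.Adj (.inr (ℓ, p)) (fragmentTarget ℓ u z))) = true := by
  obtain ⟨hadj, hspoke, hxy, hxz, hyz⟩ := h
  refine exactlyOne_of_isPerfectMatching hM (fun w hw => ?_) (fragmentTarget_ne hu hxy)
    (fragmentTarget_ne hu hxz) (fragmentTarget_ne hu hyz)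
  rcases treelikeSnark_adj_inr hu hw with ⟨q, hq, rfl⟩ | ⟨i, hi, rfl⟩
  · rcases hadj q hq with h | h | h <;> simp [h]
  · rcases hspoke i hi with h | h | h <;> simp [h]

/-- The edges of the fragment, in the numbering of `IsFragmentMatching`. -/
def fragmentEdge : ℕ → PetersenFragmentVertex × (PetersenFragmentVertex ⊕ Fin 5)
  | 0 => (petersenFragmentSpoke 0, .inr 0)
  | 1 => (petersenFragmentSpoke 1, .inr 1)
  | 2 => (petersenFragmentSpoke 2, .inr 2)
  | 3 => (petersenFragmentSpoke 3, .inr 3)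
  | 4 => (petersenFragmentSpoke 4, .inr 4)
  | 5 => (.inl ⟨1, by decide⟩, .inl (.inr 0))
  | 6 => (.inl ⟨1, by decide⟩, .inl (.inr 1))
  | 7 => (.inl ⟨2, by decide⟩, .inl (.inr 0))
  | 8 => (.inl ⟨6, by decide⟩, .inl (.inr 1))
  | 9 => (.inl ⟨2, by decide⟩, .inl (.inl ⟨3, by decide⟩))
  | 10 => (.inl ⟨3, by decide⟩, .inl (.inl ⟨4, by decide⟩))
  | 11 => (.inl ⟨2, by decide⟩, .inl (.inl ⟨7, by decide⟩))
  | 12 => (.inl ⟨3, by decide⟩, .inl (.inl ⟨8, by decide⟩))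
  | 13 => (.inl ⟨4, by decide⟩, .inl (.inl ⟨9, by decide⟩))
  | 14 => (.inl ⟨5, by decide⟩, .inl (.inl ⟨7, by decide⟩))
  | 15 => (.inl ⟨7, by decide⟩, .inl (.inl ⟨9, by decide⟩))
  | 16 => (.inl ⟨6, by decide⟩, .inl (.inl ⟨9, by decide⟩))
  | 17 => (.inl ⟨6, by decide⟩, .inl (.inl ⟨8, by decide⟩))
  | _ => (.inl ⟨5, by decide⟩, .inl (.inl ⟨8, by decide⟩))

set_option synthInstance.maxSize 1000 in
set_option synthInstance.maxHeartbeats 200000 in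
theorem isFragmentMatching_of_isPerfectMatching {M : H.treelikeSnark.Subgraph}
    (hM : M.IsPerfectMatching) [DecidableRel M.Adj] {ℓ : {v : V // IsLeafOf H.tree v}} {u : V}
    (hu : H.tree.Adj ℓ u) :
    IsFragmentMatching fun e =>
      decide (M.Adj (.inr (ℓ, (fragmentEdge e).1)) (fragmentTarget ℓ u (fragmentEdge e).2)) := by
  -- An edge inside the fragment is seen from both of its ends; this turns it to the direction fixed
  -- by `fragmentEdge`.
  have comm : ∀ p q, M.Adj (.inr (ℓ, p)) (fragmentTarget ℓ u (.inl q)) ↔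
      M.Adj (.inr (ℓ, q)) (fragmentTarget ℓ u (.inl p)) := fun p q => M.adj_comm _ _
  let v (k : Fin 10) (hk : k ≠ 0) : PetersenFragmentVertex := .inl ⟨k, hk⟩
  have h1 := exactlyOne_fragment hM hu (v 1 (by decide)) (.inl (.inr 0)) (.inl (.inr 1)) (.inr 2)
    (by decide +kernel)
  have hs := exactlyOne_fragment hM hu (.inr 0) (.inl (v 1 (by decide))) (.inl (v 2 (by decide)))
    (.inr 0) (by decide +kernel)
  have ht := exactlyOne_fragment hM hu (.inr 1) (.inl (v 1 (by decide))) (.inl (v 6 (by decide)))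
    (.inr 1) (by decide +kernel)
  have h2 := exactlyOne_fragment hM hu (v 2 (by decide)) (.inl (.inr 0)) (.inl (v 3 (by decide)))
    (.inl (v 7 (by decide))) (by decide +kernel)
  have h6 := exactlyOne_fragment hM hu (v 6 (by decide)) (.inl (.inr 1)) (.inl (v 8 (by decide)))
    (.inl (v 9 (by decide))) (by decide +kernel)
  have h3 := exactlyOne_fragment hM hu (v 3 (by decide)) (.inl (v 2 (by decide)))
    (.inl (v 4 (by decide))) (.inl (v 8 (by decide))) (by decide +kernel)
  have h4 := exactlyOne_fragment hM hu (v 4 (by decide)) (.inl (v 3 (by decide)))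
    (.inl (v 9 (by decide))) (.inr 3) (by decide +kernel)
  have h7 := exactlyOne_fragment hM hu (v 7 (by decide)) (.inl (v 2 (by decide)))
    (.inl (v 5 (by decide))) (.inl (v 9 (by decide))) (by decide +kernel)
  have h9 := exactlyOne_fragment hM hu (v 9 (by decide)) (.inl (v 4 (by decide)))
    (.inl (v 7 (by decide))) (.inl (v 6 (by decide))) (by decide +kernel)
  have h8 := exactlyOne_fragment hM hu (v 8 (by decide)) (.inl (v 3 (by decide)))
    (.inl (v 6 (by decide))) (.inl (v 5 (by decide))) (by decide +kernel)
  have h5 := exactlyOne_fragment hM hu (v 5 (by decide)) (.inl (v 7 (by decide)))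
    (.inl (v 8 (by decide))) (.inr 4) (by decide +kernel)
  simp only [comm (.inr 0)] at hs
  simp only [comm (.inr 1)] at ht
  simp only [comm (v 3 _) (v 2 _)] at h3
  simp only [comm (v 4 _) (v 3 _)] at h4
  simp only [comm (v 7 _) (v 2 _), comm (v 7 _) (v 5 _)] at h7
  simp only [comm (v 9 _)] at h9
  simp only [comm (v 8 _)] at h8
  exact ⟨h1, hs, ht, h2, h6, h3, h4, h7, h9, h8, h5⟩

end CubicHalinGraph

/-! ### The end states of sequences of fragments -/

open Classical in
/-- The colour set of the edge `xy`, where the colour classes are the subgraphs `M i`. -/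
noncomputable def pairColour {W : Type*} {G : SimpleGraph W} (M : Fin 4 → G.Subgraph) (x y : W) :
    BitVec 4 :=
  colourSet fun i => decide ((M i).Adj x y)

theorem pairColour_comm {W : Type*} {G : SimpleGraph W} (M : Fin 4 → G.Subgraph) (x y : W) :
    pairColour M x y = pairColour M y x :=
  congrArg colourSet (funext fun i => decide_eq_decide.2 ((M i).adj_comm x y))

theorem pairColour_ne_zero {W : Type*} {G : SimpleGraph W} {M : Fin 4 → G.Subgraph}
    (hcov : ∀ x y, G.Adj x y → ∃ i, (M i).Adj x y) {x y : W} (h : G.Adj x y) :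
    pairColour M x y ≠ 0 :=
  colourSet_ne_zero (by simpa using hcov x y h)

namespace CubicHalinGraph

variable {V : Type*} {H : CubicHalinGraph V}

/-- The state of the pair of edges which enter the fragment of `ℓ`. -/
noncomputable def inState (M : Fin 4 → H.treelikeSnark.Subgraph)
    (ℓ : {v : V // IsLeafOf H.tree v}) : PairState :=
  pairState
    (pairColour M (.inr (ℓ, petersenFragment.spoke 0))
      (.inr (H.next.symm ℓ, petersenFragment.spoke 4)))
    (pairColour M (.inr (ℓ, petersenFragment.spoke 1))
      (.inr (H.next.symm ℓ, petersenFragment.spoke 3)))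

/-- The state of the pair of edges which leave the fragment of `ℓ`. -/
noncomputable def outState (M : Fin 4 → H.treelikeSnark.Subgraph)
    (ℓ : {v : V // IsLeafOf H.tree v}) : PairState :=
  pairState
    (pairColour M (.inr (ℓ, petersenFragment.spoke 3)) (.inr (H.next ℓ, petersenFragment.spoke 1)))
    (pairColour M (.inr (ℓ, petersenFragment.spoke 4)) (.inr (H.next ℓ, petersenFragment.spoke 0)))

/-- The junction crosses the pairs, `a₄` to `a₂` and `a₅` to `a₁`; this is harmless because a state
is symmetric in its two edges. -/
theorem outState_eq (M : Fin 4 → H.treelikeSnark.Subgraph) (ℓ : {v : V // IsLeafOf H.tree v}) :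
    outState M ℓ = inState M (H.next ℓ) := by
  rw [outState, inState, pairState_comm, Equiv.symm_apply_apply]
  congr 1 <;> exact pairColour_comm _ _ _

theorem singleRel_leaf {M : Fin 4 → H.treelikeSnark.Subgraph}
    (hM : ∀ i, (M i).IsPerfectMatching)
    (hcov : ∀ x y, H.treelikeSnark.Adj x y → ∃ i, (M i).Adj x y)
    (ℓ : {v : V // IsLeafOf H.tree v}) {u : V} (hu : H.tree.Adj ℓ u) :
    SingleRel (inState M ℓ) (outState M ℓ) ∧
      pairColour M (H.attachPoint ℓ) (H.attachPoint u) =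
        treeColour (inState M ℓ) (outState M ℓ) := by
  classical
  rw [attachPoint_of_isLeafOf ℓ.2]
  -- With the numbering of `fragmentEdge`, edges `0, 1` give `inState`, edges `3, 4` give
  -- `outState`, and edge `2` is the tree edge.
  refine fragmentStates_of_cover
    (f := fun i e => decide ((M i).Adj (.inr (ℓ, (fragmentEdge e).1))
      (fragmentTarget ℓ u (fragmentEdge e).2)))
    (fun i => isFragmentMatching_of_isPerfectMatching (hM i) hu) fun e he => ?_
  simp only [decide_eq_true_eq]
  apply hcov
  by_cases h : e < 5
  · interval_cases e
    exacts [treelikeSnark_adj_inr_target ℓ hu 0, treelikeSnark_adj_inr_target ℓ hu 1,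
      treelikeSnark_adj_inr_target ℓ hu 2, treelikeSnark_adj_inr_target ℓ hu 3,
      treelikeSnark_adj_inr_target ℓ hu 4]
  · interval_cases e <;> first | omega | exact treelikeSnark_adj_inl_target ℓ u (by decide +kernel)

theorem pairColour_branch [Finite V] {M : Fin 4 → H.treelikeSnark.Subgraph}
    (hM : ∀ i, (M i).IsPerfectMatching) {d : H.tree.Dart} (hd : ¬ IsLeafOf H.tree d.fst) :
    pairColour M (H.attachPoint d.fst) (H.attachPoint (H.rot d).snd) &&&
        pairColour M (H.attachPoint d.fst) (H.attachPoint (H.rot (H.rot d)).snd) = 0 ∧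
      pairColour M (H.attachPoint d.fst) (H.attachPoint d.snd) =
        ~~~(pairColour M (H.attachPoint d.fst) (H.attachPoint (H.rot d).snd) ^^^
          pairColour M (H.attachPoint d.fst) (H.attachPoint (H.rot (H.rot d)).snd)) := by
  classical
  obtain ⟨-, h01, h02, h12, hall⟩ :=
    rot_of_degree_eq_three d (degree_eq_three_of_not_isLeafOf hd)
  have h1 : (H.rot d).fst = d.fst := H.isRotationSystem.fst_eq d
  have h2 : (H.rot (H.rot d)).fst = d.fst := (H.isRotationSystem.fst_eq _).trans h1
  have hne : ∀ {e e' : H.tree.Dart}, e.fst = e'.fst → e ≠ e' →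
      H.attachPoint e.snd ≠ H.attachPoint e'.snd := fun h hne h' =>
    hne (SimpleGraph.Dart.ext _ _ (Prod.ext h (attachPoint_injective h')))
  refine colourSet_partition fun i => exactlyOne_of_isPerfectMatching (hM i) (fun w hw => ?_)
    (hne (h1.trans h2.symm) h12) (hne h1 h01.symm) (hne h2 h02.symm)
  rw [attachPoint_of_not_isLeafOf hd] at hw
  obtain ⟨u, hu, rfl⟩ := treelikeSnark_adj_inl.1 hw
  rcases hall ⟨(d.fst, u), hu⟩ rfl with h | h | h
  · exact Or.inr (Or.inr (by rw [← h]))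
  · exact Or.inl (by rw [← h])
  · exact Or.inr (Or.inl (by rw [← h]))

/-- The part of the snark beyond the dart `d` is a sequence of fragments, from that of the first
leaf to that of the last leaf, with related end states. -/
theorem exists_rel_of_dart [Finite V] {M : Fin 4 → H.treelikeSnark.Subgraph}
    (hM : ∀ i, (M i).IsPerfectMatching)
    (hcov : ∀ x y, H.treelikeSnark.Adj x y → ∃ i, (M i).Adj x y)
    {r : V} (d : H.tree.Dart) (hd : d.fst = r) :
    ∃ a b, H.FirstLeaf d a ∧ H.LastLeaf d b ∧
      (IsLeafOf H.tree d.snd ∧ SingleRel (inState M a) (outState M b) ∨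
        CompositeRel (inState M a) (outState M b)) ∧
      pairColour M (H.attachPoint d.fst) (H.attachPoint d.snd) =
        treeColour (inState M a) (outState M b) := by
  refine dart_induction r (P := fun d => ∃ a b, H.FirstLeaf d a ∧ H.LastLeaf d b ∧
      (IsLeafOf H.tree d.snd ∧ SingleRel (inState M a) (outState M b) ∨
        CompositeRel (inState M a) (outState M b)) ∧
      pairColour M (H.attachPoint d.fst) (H.attachPoint d.snd) =
        treeColour (inState M a) (outState M b)) (fun d hleaf => ?_) (fun d hleaf ih₁ ih₂ => ?_) d hd
  · obtain ⟨h1, h2⟩ := singleRel_leaf hM hcov ⟨d.snd, hleaf⟩ d.adj.symm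
    exact ⟨_, _, firstLeaf_of_isLeafOf hleaf, lastLeaf_of_isLeafOf hleaf, Or.inl ⟨hleaf, h1⟩,
      (pairColour_comm _ _ _).trans h2⟩
  · obtain ⟨a₁, b₁, ha₁, hb₁, hrel₁, hcol₁⟩ := ih₁
    obtain ⟨a₂, b₂, ha₂, hb₂, hrel₂, hcol₂⟩ := ih₂
    obtain ⟨hrot, -⟩ := rot_of_degree_eq_three d.symm (degree_eq_three_of_not_isLeafOf hleaf)
    have h1 : (H.rot d.symm).fst = d.snd := H.isRotationSystem.fst_eq _
    have h2 : (H.rot (H.rot d.symm)).fst = d.snd := (H.isRotationSystem.fst_eq _).trans h1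
    have hleaf₁ : ¬ IsLeafOf H.tree (H.rot d.symm).fst := by rwa [h1]
    -- The walk comes back from the first subtree and turns straight into the second, so the two
    -- runs are consecutive on the circuit and share a state.
    have hnext : H.next b₁ = a₂ := hb₁.next_eq (FirstLeaf.of_contourStep hleaf₁ (by
      rwa [contourStep, SimpleGraph.Dart.symm_symm]))
    have hstate : outState M b₁ = inState M a₂ := by rw [outState_eq, hnext]
    obtain ⟨hdisj, hcol⟩ := pairColour_branch hM (d := d.symm) hleaf
    rw [h1] at hcol₁
    rw [h2] at hcol₂
    change pairColour M (H.attachPoint d.snd) (H.attachPoint d.fst) = _ at hcol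
    change pairColour M (H.attachPoint d.snd) _ &&& pairColour M (H.attachPoint d.snd) _ = 0 at hdisj
    change _ = ~~~(pairColour M (H.attachPoint d.snd) _ ^^^
      pairColour M (H.attachPoint d.snd) _) at hcol
    rw [hcol₁, hcol₂, hstate] at hdisj hcol
    rw [hstate] at hrel₁
    refine ⟨a₁, b₂, FirstLeaf.of_contourStep hleaf ha₁, hb₂.of_contourStep (by rwa [h2])
      (by rw [contourStep, SimpleGraph.Dart.symm_symm, hrot]), Or.inr ?_, ?_⟩
    -- If the two tree colours exhausted all four colours, the edge of `d` would be uncovered.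
    · refine compositeRel_of_comp (hrel₁.imp_left And.right) (hrel₂.imp_left And.right) hdisj ?_
      intro h
      refine pairColour_ne_zero hcov (treelikeSnark_adj_attachPoint d.adj.symm) ?_
      rw [hcol, h]
      rfl
    · rw [pairColour_comm, hcol, treeColour_trans]

/-- The treelike snark has no cover by four perfect matchings. -/
theorem not_exists_cover [Finite V] {M : Fin 4 → H.treelikeSnark.Subgraph}
    (hM : ∀ i, (M i).IsPerfectMatching)
    (hcov : ∀ x y, H.treelikeSnark.Adj x y → ∃ i, (M i).Adj x y) : False := by
  obtain ⟨r, hr⟩ := H.exists_isLeafOf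
  obtain ⟨u, hu⟩ := exists_adj_of_isLeafOf hr
  obtain ⟨a, b, ha, hb, hrel, -⟩ := exists_rel_of_dart hM hcov ⟨(r, u), hu⟩ rfl
  -- Seen from the leaf `r`, the rest of the tree is not a single leaf, so its run has at least two
  -- fragments.
  have hcomp := hrel.resolve_left fun h => not_isLeafOf_of_adj hr hu h.1
  have ha' : H.next ⟨r, hr⟩ = a :=
    FirstLeaf.unique (H.next_contour ⟨r, hr⟩ ⟨(r, u), hu⟩ rfl) ha
  -- The reverse of the dart leaving `r` ends at `r`, so `r` follows the last leaf of the run.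
  have hb' : H.next b = ⟨r, hr⟩ := hb.next_eq (firstLeaf_of_isLeafOf (d := ⟨(u, r), hu.symm⟩) hr)
  have hsingle := (singleRel_leaf hM hcov ⟨r, hr⟩ hu).1
  rw [outState_eq, ha'] at hsingle
  rw [outState_eq, hb'] at hcomp
  exact not_singleRel_of_compositeRel hcomp hsingle

end CubicHalinGraph

theorem theorem5p1 {V : Type*} [Finite V] (H : CubicHalinGraph V) :
    5 ≤ excessiveIndex H.treelikeSnark := by
  refine le_iInf₂ fun 𝓜 h𝓜 => ?_
  obtain ⟨hperf, hcover⟩ := h𝓜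
  by_contra! hlt
  have hfin : 𝓜.Finite := Set.finite_of_encard_le_coe (k := 5) hlt.le
  have hcard : 𝓜.ncard ≤ 4 := by
    rw [← hfin.cast_ncard_eq] at hlt
    have : 𝓜.ncard < 5 := by exact_mod_cast hlt
    omega
  obtain ⟨r, hr⟩ := H.exists_isLeafOf
  obtain ⟨u, hu⟩ := CubicHalinGraph.exists_adj_of_isLeafOf hr
  obtain ⟨M₀, hM₀, -⟩ := hcover _ ((SimpleGraph.mem_edgeSet _).2
    (CubicHalinGraph.treelikeSnark_adj_attachPoint hu))
  have : Nonempty 𝓜 := ⟨⟨M₀, hM₀⟩⟩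
  have := hfin.fintype
  -- A cover by fewer than four matchings is listed with repetitions: a left inverse of an embedding
  -- into `Fin 4` indexes it by exactly four colours.
  obtain ⟨g⟩ : Nonempty (𝓜 ↪ Fin 4) := Function.Embedding.nonempty_of_card_le (by
    rwa [Fintype.card_fin, ← Nat.card_eq_fintype_card, Nat.card_coe_set_eq])
  refine CubicHalinGraph.not_exists_cover (M := fun i => (Function.invFun g i).val)
    (fun i => hperf _ (Function.invFun g i).2) fun x y hxy => ?_
  obtain ⟨N, hN, hxyN⟩ := hcover s(x, y) hxy
  refine ⟨g ⟨N, hN⟩, ?_⟩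
  rw [Function.leftInverse_invFun g.injective]
  exact SimpleGraph.Subgraph.mem_edgeSet.1 hxyN
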